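/- Let $n$ be a natural number, let $\alpha\in(0,1)$, and let $\omega\subset\mathbb R^n$ be an $\alpha$-exponentially thick set, i.e. $\omega$ is Lebesgue measurable and there exist $C_0,c_0,L_0>0$ such that $$\mathrm{Leb}(\omega\cap B(x,L))\ \ge\ c_0\,e^{-C_0L^{-\alpha}}\,\mathrm{Leb}(B(x,L))\qquad\text{for all } 0<L<L_0 \text{ and all } x\in\mathbb R^n .$$ For $\lambda\ge 0$ let $\mathcal E_\lambda=\operatorname{Ran}\mathbb 1_{(-\infty,\lambda]}(-\Delta)\subset L^2(\mathbb R^n)$ be the spectral subspace of the Laplacian, that is, the space of all $f\in L^2(\mathbb R^n)$ whose Fourier transform $\widehat f(\xi)=\int_{\mathbb R^n}e^{-ix\cdot\xi}f(x)\,dx$ (extended to $L^2$) vanishes for almost every $\xi$ with $|\xi|^2>\lambda$. Then there exists a constant $c>0$ such that $$\forall \lambda>0,\ \forall f\in\mathcal E_\lambda,\qquad \|f\|_{L^2(\mathbb R^n)}\le c\,e^{c\lambda^{\alpha/2}}\,\|f\|_{L^2(\omega)} .$$ -/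

import Mathlib

open MeasureTheory FourierTransform

noncomputable section

/-- The complex Hilbert space `L²(ℝⁿ)`, with `ℝⁿ` Euclidean and carrying Lebesgue measure. -/
abbrev L2Space (n : ℕ) : Type := Lp (α := EuclideanSpace ℝ (Fin n)) ℂ 2 volume

/-- `α`-exponential thickness of a set `ω ⊆ ℝⁿ`: `ω` is Lebesgue measurable and there are
`C, c, L₀ > 0` such that `Leb (ω ∩ B(x, L)) ≥ c exp (-C L^(-α)) Leb (B(x, L))`
for all `0 < L < L₀` and all `x`. -/
def ExponentiallyThick {n : ℕ} (α : ℝ) (ω : Set (EuclideanSpace ℝ (Fin n))) : Prop :=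
  NullMeasurableSet ω volume ∧
    ∃ C c L₀ : ℝ, 0 < C ∧ 0 < c ∧ 0 < L₀ ∧
      ∀ L : ℝ, 0 < L → L < L₀ → ∀ x : EuclideanSpace ℝ (Fin n),
        ENNReal.ofReal (c * Real.exp (-C * L ^ (-α))) * volume (Metric.ball x L)
          ≤ volume (ω ∩ Metric.ball x L)

/-- The symbol of `-Δ` on `ℝⁿ`. Mathlib's Fourier transform has the kernel `exp (-2πi ⟨x, ξ⟩)`,
so `-Δ` is the multiplication by `|2πξ|²` on the Fourier side. -/
def negLaplacianSymbol {n : ℕ} (ξ : EuclideanSpace ℝ (Fin n)) : ℝ := (2 * Real.pi * ‖ξ‖) ^ 2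

theorem measurable_negLaplacianSymbol (n : ℕ) :
    Measurable (negLaplacianSymbol : EuclideanSpace ℝ (Fin n) → ℝ) := by
  unfold negLaplacianSymbol
  fun_prop

theorem measurableSet_preimage_negLaplacianSymbol (n : ℕ) {S : Set ℝ} (hS : MeasurableSet S) :
    MeasurableSet {ξ : EuclideanSpace ℝ (Fin n) | negLaplacianSymbol ξ ∈ S} :=
  measurable_negLaplacianSymbol n hS

/-- The multiplication operator `g ↦ 𝟙_A g` on `L²(ℝⁿ)`, for a measurable set `A ⊆ ℝⁿ`. -/
def mulIndicatorL2 {n : ℕ} {A : Set (EuclideanSpace ℝ (Fin n))} (hA : MeasurableSet A)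
    (g : L2Space n) : L2Space n :=
  ((Lp.memLp g).indicator hA).toLp

/-- The spectral projection `𝟙_S(-Δ)` on `L²(ℝⁿ)` for a Borel set `S ⊆ ℝ`. As the Fourier
transform diagonalizes `-Δ`, it is `f ↦ 𝓕⁻¹ (𝟙_S(|2πξ|²) 𝓕 f)`, with the `L²` Fourier transform. -/
def spectralProjNegLaplacian {n : ℕ} {S : Set ℝ} (hS : MeasurableSet S) (f : L2Space n) :
    L2Space n :=
  𝓕⁻ (mulIndicatorL2 (measurableSet_preimage_negLaplacianSymbol n hS) (𝓕 f))

/-- The spectral subspace `E_l = Ran 𝟙_{(-∞, l]}(-Δ)` of `L²(ℝⁿ)`. -/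
def spectralSubspace (n : ℕ) (l : ℝ) : Set (L2Space n) :=
  Set.range (spectralProjNegLaplacian (measurableSet_Iic (a := l)))

end

open scoped ENNReal

/-! ### The inverse Fourier transform on L¹ ∩ L². -/

section Plancherel

variable {V : Type*} [NormedAddCommGroup V] [InnerProductSpace ℝ V] [FiniteDimensional ℝ V]
  [MeasurableSpace V] [BorelSpace V]

/-! A function with frequencies |2πξ| ≤ √λ varies little on balls of radius L = ε/√λ, with ε small
depending on n. Its Taylor series and Plancherel make this precise: `exists_oscillation_bound` gives
a majorant M of the oscillation of f on balls of radius L with ‖M‖ ≤ (exp(nε) - 1)‖f‖ in L².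
Averaging |f(x)| ≤ |f(y)| + M(x) over y ∈ ω ∩ B(x, L) and using Tonelli
(`lintegral_sq_le_of_oscillation`) bounds ‖f‖² by 2/γ times the mass on ω plus 2‖M‖², where γ is the
density of ω at scale L; the last term is absorbed on the left.

The resulting loss is 2γ^(-1/2), and thickness gives γ^(-1/2) ≈ exp(C L^(-α)/2) = exp(C' λ^(α/2)),
the desired cost. For small λ, L is capped at L₀/2, which only changes the constant. -/

theorem integral_smul_fourierInv_eq {φ g : V → ℂ} (hφ : Integrable φ) (hg : Integrable g) :
    ∫ ξ, 𝓕⁻ φ ξ • g ξ = ∫ x, φ x • 𝓕⁻ g x := by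
  have h := VectorFourier.integral_fourierIntegral_smul_eq_flip (μ := volume) (ν := volume)
    (L := -innerₗ V) (e := Real.fourierChar) Real.continuous_fourierChar
    (by simp only [LinearMap.neg_apply, innerₗ_apply_apply]; fun_prop) hφ hg
  have hL : (-innerₗ V).flip = -innerₗ V := by
    ext x y; simp [real_inner_comm]
  rw [hL] at h
  exact h

theorem continuous_fourierInv {g : V → ℂ} (hg : Integrable g) : Continuous (𝓕⁻ g) :=
  VectorFourier.fourierIntegral_continuous (L := -innerₗ V) (e := Real.fourierChar)
    Real.continuous_fourierChar (by simp only [LinearMap.neg_apply, innerₗ_apply_apply]; fun_prop) hg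

/-- The inverse Fourier transform on `L²` is given by the integral formula on `L¹ ∩ L²`. -/
theorem coeFn_fourierInv_toLp {g : V → ℂ} (hg : Integrable g) (hg2 : MemLp g 2) :
    ⇑(𝓕⁻ (hg2.toLp g) : Lp ℂ 2 (volume : Measure V)) =ᵐ[volume] 𝓕⁻ g := by
  -- Both sides are tested against smooth compactly supported functions: the L² transform agrees
  -- with the distributional one, and the multiplication formula moves the transform back onto g.
  refine ae_eq_of_integral_contDiff_smul_eq ((Lp.memLp _).locallyIntegrable (by norm_num))
    (continuous_fourierInv hg).locallyIntegrable fun u hu hcu => ?_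
  have hg₁ : HasCompactSupport (Complex.ofRealCLM ∘ u) := hcu.comp_left rfl
  have hg₂ : ContDiff ℝ (⊤ : ℕ∞) (Complex.ofRealCLM ∘ u) := by fun_prop
  set φ : SchwartzMap V ℂ := hg₁.toSchwartzMap hg₂ with hφ
  have key := DFunLike.congr_fun (Lp.fourierInv_toTemperedDistribution_eq (hg2.toLp g)) φ
  rw [TemperedDistribution.fourierInv_apply, Lp.toTemperedDistribution_apply,
    Lp.toTemperedDistribution_apply] at key
  have e1 : ∫ x, (𝓕⁻ φ) x • (hg2.toLp g) x = ∫ x, (𝓕⁻ (φ : V → ℂ)) x • g x := by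
    refine integral_congr_ae ?_
    filter_upwards [hg2.coeFn_toLp] with x hx
    rw [hx, SchwartzMap.fourierInv_coe]
  rw [e1, integral_smul_fourierInv_eq φ.integrable hg] at key
  simpa [hφ] using key.symm

/-- Plancherel's theorem on `L¹ ∩ L²`. -/
theorem eLpNorm_fourierInv_eq {g : V → ℂ} (hg : Integrable g) (hg2 : MemLp g 2) :
    eLpNorm (𝓕⁻ g) 2 volume = eLpNorm g 2 volume := by
  rw [← eLpNorm_congr_ae (coeFn_fourierInv_toLp hg hg2), ← eLpNorm_congr_ae hg2.coeFn_toLp,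
    ← Lp.enorm_def, ← Lp.enorm_def, ← ofReal_norm, ← ofReal_norm]
  congr 1
  exact (Lp.fourierTransformₗᵢ V ℂ).symm.norm_map _

end Plancherel

/-! ### Cauchy–Schwarz for series in `ℝ≥0∞`, and the exponential series. -/

theorem ENNReal.two_mul_mul_le_sq_add_sq (a b : ℝ≥0∞) : 2 * (a * b) ≤ a ^ 2 + b ^ 2 := by
  rcases eq_or_ne a ∞ with rfl | ha
  · simp
  rcases eq_or_ne b ∞ with rfl | hb
  · simp
  lift a to NNReal using ha
  lift b to NNReal using hb
  have := two_mul_le_add_sq a b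
  rw [mul_assoc] at this
  exact_mod_cast this

/-- The weighted Cauchy–Schwarz inequality. -/
theorem ENNReal.tsum_mul_sq_le {ι : Type*} (w s : ι → ℝ≥0∞) :
    (∑' i, w i * s i) ^ 2 ≤ (∑' i, w i) * ∑' i, w i * s i ^ 2 := by
  -- The square is a double sum, and 2 sᵢsⱼ ≤ sᵢ² + sⱼ² applies termwise; the factor 2 is cancelled
  -- at the end.
  have h2 : 2 * (∑' i, w i * s i) ^ 2 ≤ 2 * ((∑' i, w i) * ∑' i, w i * s i ^ 2) := by
    calc 2 * (∑' i, w i * s i) ^ 2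
        = ∑' i, ∑' j, w i * w j * (2 * (s i * s j)) := by
          rw [sq, ← ENNReal.tsum_mul_right, ← ENNReal.tsum_mul_left]
          refine tsum_congr fun i => ?_
          rw [← ENNReal.tsum_mul_left, ← ENNReal.tsum_mul_left]
          exact tsum_congr fun j => by ring
      _ ≤ ∑' i, ∑' j, (w i * (w j * s j ^ 2) + w j * (w i * s i ^ 2)) := by
          refine ENNReal.tsum_le_tsum fun i => ENNReal.tsum_le_tsum fun j => ?_
          calc w i * w j * (2 * (s i * s j)) ≤ w i * w j * (s i ^ 2 + s j ^ 2) := by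
                gcongr; exact ENNReal.two_mul_mul_le_sq_add_sq _ _
            _ = _ := by ring
      _ = 2 * ((∑' i, w i) * ∑' i, w i * s i ^ 2) := by
          simp_rw [ENNReal.tsum_add, ENNReal.tsum_mul_left, ENNReal.tsum_mul_right,
            ENNReal.tsum_mul_left]
          ring
  exact (ENNReal.mul_le_mul_iff_right (by norm_num) (by norm_num)).1 h2

theorem Real.hasSum_exp_sub_one (t : ℝ) :
    HasSum (fun k : ℕ => t ^ (k + 1) / (k + 1).factorial) (Real.exp t - 1) := by
  have := NormedSpace.expSeries_div_hasSum_exp (𝔸 := ℝ) t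
  rw [← Real.exp_eq_exp_ℝ] at this
  simpa using (hasSum_nat_add_iff' 1).2 this

theorem eLpNorm_two_sq {X F : Type*} [MeasurableSpace X] [NormedAddCommGroup F] (f : X → F)
    (μ : Measure X) : eLpNorm f 2 μ ^ 2 = ∫⁻ x, ‖f x‖ₑ ^ 2 ∂μ := by
  simpa using eLpNorm_nnreal_pow_eq_lintegral (p := 2) (μ := μ) (f := f) (by norm_num)

/-! ### Taylor expansion and L² control of the oscillation. -/

section Oscillation

variable {n : ℕ}

/-- The monomial `∏ᵢ (i ξ_{pᵢ} / R)`, the symbol of an iterated partial derivative. -/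
noncomputable def derivSymbol (R : ℝ) {k : ℕ} (p : Fin k → Fin n)
    (ξ : EuclideanSpace ℝ (Fin n)) : ℂ :=
  ∏ i, ((ξ (p i) / R : ℝ) : ℂ) * Complex.I

theorem continuous_derivSymbol (R : ℝ) {k : ℕ} (p : Fin k → Fin n) :
    Continuous (derivSymbol R p) := by
  unfold derivSymbol; fun_prop

theorem norm_derivSymbol_le_one {R : ℝ} (hR : 0 < R) {k : ℕ} (p : Fin k → Fin n)
    {ξ : EuclideanSpace ℝ (Fin n)} (hξ : ‖ξ‖ ≤ R) : ‖derivSymbol R p ξ‖ ≤ 1 := by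
  rw [derivSymbol, norm_prod]
  refine Finset.prod_le_one (fun _ _ => norm_nonneg _) fun i _ => ?_
  rw [norm_mul, Complex.norm_I, mul_one, Complex.norm_real, norm_div, Real.norm_of_nonneg hR.le]
  exact div_le_one_of_le₀ ((PiLp.norm_apply_le ξ (p i)).trans hξ) hR.le

/-- Separates ξ from h, so that the oscillation can be bounded uniformly in h. Summing over words p
rather than multi-indices avoids multinomial coefficients. -/
theorem two_pi_inner_mul_I_pow {R : ℝ} (hR : 0 < R) (ξ h : EuclideanSpace ℝ (Fin n)) (k : ℕ) :
    (2 * Real.pi * (inner ℝ ξ h : ℝ) * Complex.I : ℂ) ^ k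
      = ∑ p : Fin k → Fin n, ((∏ i, 2 * Real.pi * R * h (p i) : ℝ) : ℂ) * derivSymbol R p ξ := by
  have h1 : (2 * Real.pi * (inner ℝ ξ h : ℝ) * Complex.I : ℂ)
      = ∑ j, ((2 * Real.pi * R * h j : ℝ) : ℂ) * (((ξ j / R : ℝ) : ℂ) * Complex.I) := by
    have hR' : (R : ℂ) ≠ 0 := by exact_mod_cast hR.ne'
    simp only [PiLp.inner_apply, Complex.ofReal_sum, Finset.mul_sum, Finset.sum_mul]
    refine Finset.sum_congr rfl fun j _ => ?_
    simp
    field_simp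
  rw [h1, Fintype.sum_pow]
  refine Finset.sum_congr rfl fun p _ => ?_
  rw [derivSymbol, Finset.prod_mul_distrib, Complex.ofReal_prod]

variable {R : ℝ} {g : EuclideanSpace ℝ (Fin n) → ℂ}

theorem norm_derivSymbol_mul_le (hR : 0 < R) (hsupp : ∀ ξ, R < ‖ξ‖ → g ξ = 0) {k : ℕ}
    (p : Fin k → Fin n) (ξ : EuclideanSpace ℝ (Fin n)) : ‖derivSymbol R p ξ * g ξ‖ ≤ ‖g ξ‖ := by
  rcases le_or_gt ‖ξ‖ R with h | h
  · rw [norm_mul]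
    exact mul_le_of_le_one_left (norm_nonneg _) (norm_derivSymbol_le_one hR p h)
  · simp [hsupp ξ h]

theorem integrable_derivSymbol_mul (hR : 0 < R) (hsupp : ∀ ξ, R < ‖ξ‖ → g ξ = 0)
    (hg : Integrable g) {k : ℕ} (p : Fin k → Fin n) :
    Integrable fun ξ => derivSymbol R p ξ * g ξ :=
  hg.mono ((continuous_derivSymbol R p).aestronglyMeasurable.mul hg.1)
    (.of_forall (norm_derivSymbol_mul_le hR hsupp p))

/-- Bernstein's inequality: by Plancherel, since the symbol normalised by R is at most 1 on the
support of g. -/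
theorem lintegral_fourierInv_derivSymbol_mul_le (hR : 0 < R) (hsupp : ∀ ξ, R < ‖ξ‖ → g ξ = 0)
    (hg : Integrable g) (hg2 : MemLp g 2) {k : ℕ} (p : Fin k → Fin n) :
    ∫⁻ x, ‖𝓕⁻ (fun ξ => derivSymbol R p ξ * g ξ) x‖ₑ ^ 2 ≤ eLpNorm g 2 volume ^ 2 := by
  have hi := integrable_derivSymbol_mul hR hsupp hg p
  have h2 : MemLp (fun ξ => derivSymbol R p ξ * g ξ) 2 :=
    hg2.mono hi.1 (.of_forall (norm_derivSymbol_mul_le hR hsupp p))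
  rw [← eLpNorm_two_sq, eLpNorm_fourierInv_eq hi h2]
  gcongr
  exact eLpNorm_mono (norm_derivSymbol_mul_le hR hsupp p)

/-- The Taylor expansion of a function with compactly supported Fourier transform. -/
theorem hasSum_fourierInv_add_sub (hR : 0 < R) (hsupp : ∀ ξ, R < ‖ξ‖ → g ξ = 0)
    (hg : Integrable g) (x h : EuclideanSpace ℝ (Fin n)) :
    HasSum (fun k : ℕ => ∑ p : Fin (k + 1) → Fin n,
      ((((∏ i, 2 * Real.pi * R * h (p i)) / (k + 1).factorial : ℝ) : ℂ)
        * 𝓕⁻ (fun ξ => derivSymbol R p ξ * g ξ) x)) (𝓕⁻ g (x + h) - 𝓕⁻ g x) := by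
  have hchar : ∀ (u : EuclideanSpace ℝ (Fin n) → ℂ), Integrable u → ∀ y,
      Integrable fun ξ => Real.fourierChar (inner ℝ ξ y) • u ξ := fun u hu y => by
    have := (Real.fourierIntegral_convergent_iff (-y)).2 hu
    simpa using this
  set z : EuclideanSpace ℝ (Fin n) → ℂ := fun ξ =>
    2 * Real.pi * (inner ℝ ξ h : ℝ) * Complex.I with hz
  set Z : ℝ := 2 * Real.pi * R * ‖h‖ with hZ
  have hZs : HasSum (fun k : ℕ => Z ^ (k + 1) / (k + 1).factorial) (Real.exp Z - 1) :=
    Real.hasSum_exp_sub_one Z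
  -- The series exp z - 1 = ∑ z^(k+1)/(k+1)! is integrated termwise against g; on the support of g
  -- one has |z| ≤ Z, which supplies the dominating series.
  have key : HasSum (fun k : ℕ => ∫ ξ, Real.fourierChar (inner ℝ ξ x) •
      (z ξ ^ (k + 1) / (k + 1).factorial * g ξ))
      (∫ ξ, Real.fourierChar (inner ℝ ξ x) • ((Complex.exp (z ξ) - 1) * g ξ)) := by
    refine hasSum_integral_of_dominated_convergence
      (fun k ξ => Z ^ (k + 1) / (k + 1).factorial * ‖g ξ‖) ?_ ?_ ?_ ?_ ?_
    · intro k
      have h1 : Continuous fun ξ => z ξ ^ (k + 1) / ((k + 1).factorial : ℂ) := by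
        simp only [hz]; fun_prop
      have h2 : Continuous fun ξ : EuclideanSpace ℝ (Fin n) =>
          Real.fourierChar (inner ℝ ξ x) := by fun_prop
      exact h2.aestronglyMeasurable.smul (h1.aestronglyMeasurable.mul hg.1)
    · refine fun k => .of_forall fun ξ => ?_
      rw [Circle.norm_smul, norm_mul]
      rcases le_or_gt ‖ξ‖ R with hξ | hξ
      · gcongr
        rw [norm_div, norm_pow, Complex.norm_natCast]
        gcongr
        simp only [hz, norm_mul, Complex.norm_I, Complex.norm_real, Complex.norm_ofNat, mul_one,
          Real.norm_of_nonneg Real.pi_pos.le, hZ]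
        rw [mul_assoc (2 * Real.pi)]
        gcongr
        exact (norm_inner_le_norm ξ h).trans (by gcongr)
      · simp [hsupp ξ hξ]
    · exact .of_forall fun ξ => hZs.summable.mul_right _
    · simp_rw [tsum_mul_right]
      exact hg.norm.const_mul _
    · refine .of_forall fun ξ => ?_
      have := NormedSpace.expSeries_div_hasSum_exp (𝔸 := ℂ) (z ξ)
      rw [← Complex.exp_eq_exp_ℂ] at this
      have := (hasSum_nat_add_iff' 1).2 this
      simp only [Finset.range_one, Finset.sum_singleton, pow_zero, Nat.factorial_zero,
        Nat.cast_one, div_one] at this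
      simp only [Circle.smul_def, smul_eq_mul]
      exact (this.mul_right _).mul_left _
  have hlim : ∫ ξ, Real.fourierChar (inner ℝ ξ x) • ((Complex.exp (z ξ) - 1) * g ξ)
      = 𝓕⁻ g (x + h) - 𝓕⁻ g x := by
    rw [Real.fourierInv_eq, Real.fourierInv_eq, ← integral_sub (hchar g hg _) (hchar g hg _)]
    refine integral_congr_ae (.of_forall fun ξ => ?_)
    simp only [inner_add_right, Circle.smul_def, smul_eq_mul, Real.fourierChar_apply, hz]
    push_cast
    rw [mul_add, add_mul, Complex.exp_add]
    ring
  rw [hlim] at key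
  convert key using 2 with k
  have hpt : ∀ ξ, Real.fourierChar (inner ℝ ξ x) • (z ξ ^ (k + 1) / (k + 1).factorial * g ξ)
      = ∑ p : Fin (k + 1) → Fin n,
        (((∏ i, 2 * Real.pi * R * h (p i)) / (k + 1).factorial : ℝ) : ℂ)
          * (Real.fourierChar (inner ℝ ξ x) • (derivSymbol R p ξ * g ξ)) := fun ξ => by
    simp only [hz, two_pi_inner_mul_I_pow hR ξ h (k + 1), Circle.smul_def, smul_eq_mul,
      Finset.sum_div, Finset.sum_mul, Finset.mul_sum]
    refine Finset.sum_congr rfl fun p _ => ?_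
    push_cast
    ring
  simp_rw [hpt]
  rw [integral_finsetSum _ fun p _ =>
    (hchar _ (integrable_derivSymbol_mul hR hsupp hg p) x).const_mul _]
  refine Finset.sum_congr rfl fun p _ => ?_
  rw [integral_const_mul, Real.fourierInv_eq]

/-- There are n^(k+1) words of length k + 1, so the sum is the exponential series at nε without its
constant term. -/
theorem tsum_sigma_pow_div_factorial {ε : ℝ} (hε : 0 ≤ ε) :
    ∑' i : (k : ℕ) × (Fin (k + 1) → Fin n),
        ENNReal.ofReal (ε ^ (i.1 + 1) / (i.1 + 1).factorial)
      = ENNReal.ofReal (Real.exp (n * ε) - 1) := by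
  have h1 : HasSum (fun k : ℕ => (n * ε) ^ (k + 1) / (k + 1).factorial)
      (Real.exp (n * ε) - 1) := Real.hasSum_exp_sub_one _
  rw [ENNReal.tsum_sigma', ← h1.tsum_eq, ENNReal.ofReal_tsum_of_nonneg (fun k => by positivity)
    h1.summable]
  refine tsum_congr fun k => ?_
  simp only [tsum_fintype]
  rw [Finset.sum_const, nsmul_eq_mul, Finset.card_univ, Fintype.card_fun,
    Fintype.card_fin, Fintype.card_fin, ← ENNReal.ofReal_natCast, ← ENNReal.ofReal_mul (by simp)]
  congr 1
  push_cast
  ring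

/-- The oscillation of a function with Fourier transform supported in `‖ξ‖ ≤ R`, on balls of
radius `L`, is small in `L²` when `2πRL` is small. -/
theorem exists_oscillation_bound (hR : 0 < R) (hsupp : ∀ ξ, R < ‖ξ‖ → g ξ = 0)
    (hg : Integrable g) (hg2 : MemLp g 2) {L : ℝ} (hL : 0 ≤ L) :
    ∃ M : EuclideanSpace ℝ (Fin n) → ℝ≥0∞, Measurable M ∧
      (∀ x h, ‖h‖ ≤ L → ‖𝓕⁻ g (x + h) - 𝓕⁻ g x‖ₑ ≤ M x) ∧
      ∫⁻ x, M x ^ 2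
        ≤ ENNReal.ofReal (Real.exp (n * (2 * Real.pi * R * L)) - 1) ^ 2
          * eLpNorm g 2 volume ^ 2 := by
  set ε : ℝ := 2 * Real.pi * R * L with hε
  have hε0 : 0 ≤ ε := by positivity
  -- The weight w bounds the Taylor coefficients for all ‖h‖ ≤ L at once, and s collects the
  -- normalised derivatives; M = ∑ w s no longer depends on h.
  let w : (k : ℕ) × (Fin (k + 1) → Fin n) → ℝ≥0∞ := fun i =>
    ENNReal.ofReal (ε ^ (i.1 + 1) / (i.1 + 1).factorial)
  let s : (k : ℕ) × (Fin (k + 1) → Fin n) → EuclideanSpace ℝ (Fin n) → ℝ≥0∞ := fun i x =>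
    ‖𝓕⁻ (fun ξ => derivSymbol R i.2 ξ * g ξ) x‖ₑ
  have hs : ∀ i, Measurable (s i) := fun i =>
    (continuous_fourierInv (integrable_derivSymbol_mul hR hsupp hg i.2)).enorm.measurable
  refine ⟨fun x => ∑' i, w i * s i x, Measurable.tsum fun i => (hs i).const_mul _, ?_, ?_⟩
  · intro x h hh
    rw [← (hasSum_fourierInv_add_sub hR hsupp hg x h).tsum_eq]
    refine enorm_tsum_le_tsum_enorm.trans ?_
    dsimp only
    rw [ENNReal.tsum_sigma']
    refine ENNReal.tsum_le_tsum fun k => ?_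
    rw [tsum_fintype]
    refine (enorm_sum_le _ _).trans (Finset.sum_le_sum fun p _ => ?_)
    rw [enorm_mul]
    refine mul_le_mul_left ?_ _
    rw [← ofReal_norm, Complex.norm_real, norm_div, norm_prod, Real.norm_natCast]
    refine ENNReal.ofReal_le_ofReal ?_
    gcongr
    calc ∏ i, ‖2 * Real.pi * R * h (p i)‖ ≤ ∏ _i : Fin (k + 1), ε := by
          refine Finset.prod_le_prod (fun _ _ => norm_nonneg _) fun i _ => ?_
          rw [norm_mul, Real.norm_of_nonneg (by positivity)]
          exact mul_le_mul_of_nonneg_left ((PiLp.norm_apply_le h (p i)).trans hh) (by positivity)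
      _ = ε ^ (k + 1) := by simp
  · calc ∫⁻ x, (∑' i, w i * s i x) ^ 2
        ≤ ∫⁻ x, (∑' i, w i) * ∑' i, w i * s i x ^ 2 :=
          lintegral_mono fun x => ENNReal.tsum_mul_sq_le _ _
      _ = (∑' i, w i) * ∑' i, w i * ∫⁻ x, s i x ^ 2 := by
          rw [lintegral_const_mul _ (Measurable.tsum fun i =>
            ((hs i).pow_const 2).const_mul _),
            lintegral_tsum fun i => (((hs i).pow_const 2).const_mul _).aemeasurable]
          simp_rw [lintegral_const_mul _ ((hs _).pow_const 2)]
      _ ≤ (∑' i, w i) * ∑' i, w i * eLpNorm g 2 volume ^ 2 := by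
          gcongr with i
          exact lintegral_fourierInv_derivSymbol_mul_le hR hsupp hg hg2 i.2
      _ = _ := by
          rw [ENNReal.tsum_mul_right, tsum_sigma_pow_div_factorial hε0]
          ring

end Oscillation

/-! ### Averaging over the thick set, and absorption of the oscillation. -/

section Averaging

variable {n : ℕ}

theorem ENNReal.add_sq_le_two_mul (a b : ℝ≥0∞) : (a + b) ^ 2 ≤ 2 * a ^ 2 + 2 * b ^ 2 := by
  calc (a + b) ^ 2 = a ^ 2 + b ^ 2 + 2 * (a * b) := by ring
    _ ≤ a ^ 2 + b ^ 2 + (a ^ 2 + b ^ 2) := by gcongr; exact ENNReal.two_mul_mul_le_sq_add_sq a b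
    _ = _ := by ring

/-- A function whose oscillation on balls of radius `L` is controlled by `M` is controlled in `L²`
by its restriction to a set that has density at least `γ` in each ball of radius `L`. -/
theorem lintegral_sq_le_of_oscillation {F : EuclideanSpace ℝ (Fin n) → ℂ} (hF : Measurable F)
    {M : EuclideanSpace ℝ (Fin n) → ℝ≥0∞} (hM : Measurable M) {L : ℝ} (hL : 0 < L)
    (hosc : ∀ x h, ‖h‖ ≤ L → ‖F (x + h) - F x‖ₑ ≤ M x)
    {ω : Set (EuclideanSpace ℝ (Fin n))} (hω : MeasurableSet ω) {γ : ℝ≥0∞} (hγ0 : γ ≠ 0)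
    (hγ : ∀ x, γ * volume (Metric.ball x L) ≤ volume (ω ∩ Metric.ball x L)) :
    ∫⁻ x, ‖F x‖ₑ ^ 2 ≤ 2 * γ⁻¹ * (∫⁻ x in ω, ‖F x‖ₑ ^ 2) + 2 * ∫⁻ x, M x ^ 2 := by
  set B : ℝ≥0∞ := volume (Metric.ball (0 : EuclideanSpace ℝ (Fin n)) L) with hB
  have hball : ∀ x : EuclideanSpace ℝ (Fin n), volume (Metric.ball x L) = B := fun x =>
    Measure.addHaar_ball_center volume x L
  have hB0 : B ≠ 0 := (Metric.measure_ball_pos volume _ hL).ne'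
  have hBt : B ≠ ∞ := measure_ball_lt_top.ne
  have hFm : Measurable fun x => ‖F x‖ₑ ^ 2 := hF.enorm.pow_const 2
  have hpt : ∀ x, ‖F x‖ₑ ^ 2
      ≤ 2 * (γ * B)⁻¹ * (∫⁻ y in ω ∩ Metric.ball x L, ‖F y‖ₑ ^ 2) + 2 * M x ^ 2 := by
    intro x
    set v := volume (ω ∩ Metric.ball x L) with hv
    have hγv : γ * B ≤ v := by rw [← hball x]; exact hγ x
    have hv0 : v ≠ 0 := ((pos_iff_ne_zero.2 (mul_ne_zero hγ0 hB0)).trans_le hγv).ne'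
    have hvt : v ≠ ∞ := ((measure_mono Set.inter_subset_right).trans_lt measure_ball_lt_top).ne
    -- The inequality |F(x)| ≤ |F(y)| + M(x) is squared and integrated over y ∈ ω ∩ B(x, L), of
    -- measure v.
    have h1 : ‖F x‖ₑ ^ 2 * v
        ≤ 2 * (∫⁻ y in ω ∩ Metric.ball x L, ‖F y‖ₑ ^ 2) + 2 * M x ^ 2 * v := by
      rw [hv, ← setLIntegral_const, ← setLIntegral_const, ← lintegral_const_mul _ hFm,
        ← lintegral_add_left (hFm.const_mul 2)]
      refine setLIntegral_mono' (hω.inter measurableSet_ball) fun y hy => ?_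
      have h2 : ‖F x‖ₑ ≤ ‖F y‖ₑ + M x := by
        have h3 := hosc x (y - x) (by
          have := hy.2; rw [Metric.mem_ball, dist_eq_norm] at this; exact this.le)
        rw [add_sub_cancel] at h3
        calc ‖F x‖ₑ = ‖F y - (F y - F x)‖ₑ := by rw [sub_sub_cancel]
          _ ≤ ‖F y‖ₑ + ‖F y - F x‖ₑ := enorm_sub_le
          _ ≤ _ := by gcongr
      exact (pow_le_pow_left' h2 2).trans (ENNReal.add_sq_le_two_mul _ _)
    calc ‖F x‖ₑ ^ 2 = ‖F x‖ₑ ^ 2 * v * v⁻¹ := by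
          rw [mul_assoc, ENNReal.mul_inv_cancel hv0 hvt, mul_one]
      _ ≤ (2 * (∫⁻ y in ω ∩ Metric.ball x L, ‖F y‖ₑ ^ 2) + 2 * M x ^ 2 * v) * v⁻¹ := by gcongr
      _ = 2 * v⁻¹ * (∫⁻ y in ω ∩ Metric.ball x L, ‖F y‖ₑ ^ 2) + 2 * M x ^ 2 * (v * v⁻¹) := by ring
      _ ≤ _ := by
          rw [ENNReal.mul_inv_cancel hv0 hvt, mul_one]
          gcongr
  have hind : ∀ x, ∫⁻ y in ω ∩ Metric.ball x L, ‖F y‖ₑ ^ 2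
      = ∫⁻ y in ω, {p : EuclideanSpace ℝ (Fin n) × EuclideanSpace ℝ (Fin n) |
          dist p.2 p.1 < L}.indicator (fun p => ‖F p.2‖ₑ ^ 2) (x, y) := by
    intro x
    rw [Set.inter_comm, ← Measure.restrict_restrict measurableSet_ball,
      ← lintegral_indicator measurableSet_ball]
    rfl
  have hset : MeasurableSet {p : EuclideanSpace ℝ (Fin n) × EuclideanSpace ℝ (Fin n) |
      dist p.2 p.1 < L} :=
    measurableSet_lt (measurable_snd.dist measurable_fst) measurable_const
  have hjoint : Measurable ({p : EuclideanSpace ℝ (Fin n) × EuclideanSpace ℝ (Fin n) |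
      dist p.2 p.1 < L}.indicator fun p => ‖F p.2‖ₑ ^ 2) :=
    (hFm.comp measurable_snd).indicator hset
  -- Tonelli: each y ∈ ω lies in B(x, L) for a set of centres x of measure B.
  have hfub : ∫⁻ x, ∫⁻ y in ω ∩ Metric.ball x L, ‖F y‖ₑ ^ 2 = B * ∫⁻ y in ω, ‖F y‖ₑ ^ 2 := by
    simp_rw [hind]
    rw [lintegral_lintegral_swap (f := fun x y =>
      {p : EuclideanSpace ℝ (Fin n) × EuclideanSpace ℝ (Fin n) |
        dist p.2 p.1 < L}.indicator (fun p => ‖F p.2‖ₑ ^ 2) (x, y)) hjoint.aemeasurable, ← lintegral_const_mul _ hFm]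
    refine lintegral_congr fun y => ?_
    rw [← hball y, mul_comm, ← setLIntegral_const, ← lintegral_indicator measurableSet_ball]
    refine lintegral_congr fun x => ?_
    by_cases h : dist x y < L <;> simp [h, Set.indicator, dist_comm y x]
  have hmeas : Measurable fun x => ∫⁻ y in ω ∩ Metric.ball x L, ‖F y‖ₑ ^ 2 := by
    simp_rw [hind]
    exact hjoint.lintegral_prod_right'
  calc ∫⁻ x, ‖F x‖ₑ ^ 2
      ≤ ∫⁻ x, (2 * (γ * B)⁻¹ * (∫⁻ y in ω ∩ Metric.ball x L, ‖F y‖ₑ ^ 2) + 2 * M x ^ 2) :=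
        lintegral_mono hpt
    _ = 2 * (γ * B)⁻¹ * (B * ∫⁻ y in ω, ‖F y‖ₑ ^ 2) + 2 * ∫⁻ x, M x ^ 2 := by
        rw [lintegral_add_left (hmeas.const_mul _), lintegral_const_mul _ hmeas, hfub,
          lintegral_const_mul _ (hM.pow_const 2)]
    _ = 2 * γ⁻¹ * (B⁻¹ * B) * (∫⁻ y in ω, ‖F y‖ₑ ^ 2) + 2 * ∫⁻ x, M x ^ 2 := by
        rw [ENNReal.mul_inv (.inl hγ0) (.inr hB0)]
        ring
    _ = _ := by rw [ENNReal.inv_mul_cancel hB0 hBt, mul_one]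

/-- From exp(-t) ≥ 1 - t ≥ 3/4 one gets exp t ≤ 4/3, and 2(1/3)² < 1/2. A coefficient of 1/2 is what
allows absorption below. -/
theorem two_mul_exp_sub_one_sq_le {t : ℝ} (ht0 : 0 ≤ t) (ht : t ≤ 1 / 4) :
    2 * (Real.exp t - 1) ^ 2 ≤ 1 / 2 := by
  have h1 := Real.add_one_le_exp (-t)
  have h2 : Real.exp t * Real.exp (-t) = 1 := by rw [← Real.exp_add]; simp
  have h3 := Real.add_one_le_exp t
  have h4 : Real.exp t ≤ 4 / 3 := by nlinarith [Real.exp_pos t]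
  nlinarith

/-- A Logvinenko–Sereda inequality at scales well below the wavelength. -/
theorem eLpNorm_sq_le_of_thick_ball {R L : ℝ} (hR : 0 < R) (hL : 0 < L)
    (hRL : n * (2 * Real.pi * R * L) ≤ 1 / 4) {g : EuclideanSpace ℝ (Fin n) → ℂ}
    (hsupp : ∀ ξ, R < ‖ξ‖ → g ξ = 0) (hg : Integrable g) (hg2 : MemLp g 2)
    {ω : Set (EuclideanSpace ℝ (Fin n))} (hω : MeasurableSet ω) {γ : ℝ≥0∞} (hγ0 : γ ≠ 0)
    (hγ : ∀ x, γ * volume (Metric.ball x L) ≤ volume (ω ∩ Metric.ball x L)) :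
    eLpNorm (𝓕⁻ g) 2 volume ^ 2 ≤ 4 * γ⁻¹ * eLpNorm (𝓕⁻ g) 2 (volume.restrict ω) ^ 2 := by
  obtain ⟨M, hM, hosc, hMle⟩ := exists_oscillation_bound hR hsupp hg hg2 hL.le
  have h := lintegral_sq_le_of_oscillation (continuous_fourierInv hg).measurable hM hL hosc hω
    hγ0 hγ
  rw [← eLpNorm_two_sq, ← eLpNorm_two_sq] at h
  set A := eLpNorm (𝓕⁻ g) 2 volume ^ 2 with hA
  set D := eLpNorm (𝓕⁻ g) 2 (volume.restrict ω) ^ 2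
  -- Finiteness of A is what permits cancelling A/2 from both sides.
  have hAt : A ≠ ∞ := by
    rw [hA, eLpNorm_fourierInv_eq hg hg2]
    exact ENNReal.pow_ne_top hg2.2.ne
  have h2 : 2 * ∫⁻ x, M x ^ 2 ≤ 2⁻¹ * A := by
    calc 2 * ∫⁻ x, M x ^ 2
        ≤ 2 * (ENNReal.ofReal (Real.exp (n * (2 * Real.pi * R * L)) - 1) ^ 2
          * eLpNorm g 2 volume ^ 2) := by gcongr
      _ = ENNReal.ofReal (2 * (Real.exp (n * (2 * Real.pi * R * L)) - 1) ^ 2) * A := by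
          have h0 : 0 ≤ Real.exp (n * (2 * Real.pi * R * L)) - 1 :=
            sub_nonneg.2 (Real.one_le_exp (by positivity))
          rw [hA, eLpNorm_fourierInv_eq hg hg2, ENNReal.ofReal_mul (by norm_num),
            ENNReal.ofReal_pow h0, ENNReal.ofReal_ofNat]
          ring
      _ ≤ ENNReal.ofReal (1 / 2) * A := by
          gcongr
          exact two_mul_exp_sub_one_sq_le (by positivity) hRL
      _ = 2⁻¹ * A := by
          rw [one_div, ENNReal.ofReal_inv_of_pos (by norm_num), ENNReal.ofReal_ofNat]
  have h3 : 2⁻¹ * A + 2⁻¹ * A ≤ 2 * γ⁻¹ * D + 2⁻¹ * A := by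
    rw [← add_mul, ENNReal.inv_two_add_inv_two, one_mul]
    exact h.trans (by gcongr)
  have h4 : 2⁻¹ * A ≤ 2 * γ⁻¹ * D :=
    (ENNReal.add_le_add_iff_right (ENNReal.mul_ne_top (by norm_num) hAt)).1 h3
  calc A = 2 * (2⁻¹ * A) := by
        rw [← mul_assoc, ENNReal.mul_inv_cancel (by norm_num) (by norm_num), one_mul]
    _ ≤ 2 * (2 * γ⁻¹ * D) := by gcongr
    _ = _ := by ring

/-- Functions in the spectral subspace are inverse Fourier transforms of functions supported in a
ball. -/
theorem exists_fourierInv_of_mem_spectralSubspace {l R : ℝ} (hR : 0 ≤ R)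
    (hlR : l ≤ (2 * Real.pi * R) ^ 2) {f : L2Space n} (hf : f ∈ spectralSubspace n l) :
    ∃ g : EuclideanSpace ℝ (Fin n) → ℂ, (∀ ξ, R < ‖ξ‖ → g ξ = 0) ∧ Integrable g ∧ MemLp g 2 ∧
      ⇑f =ᵐ[volume] 𝓕⁻ g := by
  obtain ⟨f₀, rfl⟩ := hf
  set A := {ξ : EuclideanSpace ℝ (Fin n) | negLaplacianSymbol ξ ∈ Set.Iic l}
  have hA : MeasurableSet A := measurableSet_preimage_negLaplacianSymbol n measurableSet_Iic
  have hAR : A ⊆ Metric.closedBall 0 R := fun ξ hξ => by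
    have h1 : (2 * Real.pi * ‖ξ‖) ^ 2 ≤ (2 * Real.pi * R) ^ 2 := le_trans hξ hlR
    have h2 := (sq_le_sq₀ (by positivity) (by positivity)).1 h1
    rw [mem_closedBall_zero_iff]
    exact le_of_mul_le_mul_left h2 (by positivity)
  have hg2 : MemLp (A.indicator (𝓕 f₀ : L2Space n)) 2 volume := (Lp.memLp _).indicator hA
  have hg : Integrable (A.indicator (𝓕 f₀ : L2Space n)) := by
    rw [integrable_indicator_iff hA]
    -- The frequency set is bounded, so L² functions are integrable on it.
    have : IsFiniteMeasure (volume.restrict A) :=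
      ⟨by rw [Measure.restrict_apply_univ]
          exact (measure_mono hAR).trans_lt measure_closedBall_lt_top⟩
    exact ((Lp.memLp (𝓕 f₀ : L2Space n)).restrict A).integrable (by norm_num)
  refine ⟨_, fun ξ hξ => ?_, hg, hg2, coeFn_fourierInv_toLp hg hg2⟩
  refine Set.indicator_of_notMem (fun h => ?_) _
  exact hξ.not_ge (mem_closedBall_zero_iff.1 (hAR h))

end Averaging

theorem mainTheorem3 (n : ℕ) (α : ℝ) (hα0 : 0 < α) (hα1 : α < 1)
    (ω : Set (EuclideanSpace ℝ (Fin n))) (hω : ExponentiallyThick α ω) :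
    ∃ c : ℝ, 0 < c ∧ ∀ l : ℝ, 0 < l → ∀ f ∈ spectralSubspace n l,
      eLpNorm f 2 volume
        ≤ ENNReal.ofReal (c * Real.exp (c * l ^ (α / 2))) * eLpNorm f 2 (volume.restrict ω) := by
  obtain ⟨hmeas, C, c₀, L₀, hC, hc₀, hL₀, hthick⟩ := hω
  -- Averaging needs a measurable set; a null modification of ω changes neither the densities nor
  -- the norm on ω.
  obtain ⟨ω', -, hω'm, hω'⟩ := hmeas.exists_measurable_superset_ae_eq
  -- Chosen so that nε ≤ 1/4; the n + 1 keeps ε finite and positive when n = 0.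
  set ε : ℝ := 1 / (4 * (n + 1)) with hε
  have hε0 : 0 < ε := by positivity
  -- The constants a and b come from 2γ^(-1/2) = (2/√c₀) exp(C L^(-α)/2): a carries the cap L₀/2, b
  -- the scale ε/√l.
  set a : ℝ := 2 / Real.sqrt c₀ * Real.exp (C / 2 * (L₀ / 2) ^ (-α)) with ha
  set b : ℝ := C / 2 * ε ^ (-α) with hb
  have ha0 : 0 < a := by positivity
  have hb0 : 0 < b := by positivity
  refine ⟨a + b, by positivity, fun l hl f hf => ?_⟩
  set s : ℝ := Real.sqrt l with hs
  have hs0 : 0 < s := Real.sqrt_pos.2 hl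
  set L : ℝ := min (L₀ / 2) (ε / s) with hLdef
  have hL : 0 < L := lt_min (by positivity) (by positivity)
  have hLL₀ : L < L₀ := (min_le_left _ _).trans_lt (by linarith)
  -- With the kernel exp(-2πi⟨x, ξ⟩), the condition |2πξ|² ≤ l reads ‖ξ‖ ≤ √l/(2π).
  set R : ℝ := s / (2 * Real.pi) with hRdef
  have hR : 0 < R := by positivity
  have hRs : 2 * Real.pi * R = s := by rw [hRdef]; field_simp
  obtain ⟨g, hsupp, hg, hg2, hfg⟩ := exists_fourierInv_of_mem_spectralSubspace hR.le
    (by rw [hRs, Real.sq_sqrt hl.le]) hf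
  have hRL : n * (2 * Real.pi * R * L) ≤ 1 / 4 := by
    have h1 : s * L ≤ ε := by
      calc s * L ≤ s * (ε / s) := by gcongr; exact min_le_right _ _
        _ = ε := by field_simp
    rw [hRs]
    calc n * (s * L) ≤ n * ε := by gcongr
      _ ≤ (n + 1) * ε := by gcongr; linarith
      _ = 1 / 4 := by rw [hε]; field_simp
  set t : ℝ := c₀ * Real.exp (-C * L ^ (-α)) with ht
  have ht0 : 0 < t := by positivity
  have hvol : ∀ x, volume (ω' ∩ Metric.ball x L) = volume (ω ∩ Metric.ball x L) := fun x =>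
    measure_congr (hω'.inter (ae_eq_refl _))
  have hmain := eLpNorm_sq_le_of_thick_ball hR hL hRL hsupp hg hg2 hω'm
    (γ := ENNReal.ofReal t) (ENNReal.ofReal_pos.2 ht0).ne'
    (fun x => by rw [hvol]; exact hthick L hL hLL₀ x)
  rw [Measure.restrict_congr_set hω', ← eLpNorm_congr_ae hfg,
    ← eLpNorm_congr_ae (ae_restrict_of_ae hfg)] at hmain
  -- The power at a minimum is one of the two powers, hence at most their sum; this treats small and
  -- large l together.
  have hLpow : L ^ (-α) ≤ (L₀ / 2) ^ (-α) + ε ^ (-α) * l ^ (α / 2) := by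
    have hp1 : 0 < (L₀ / 2) ^ (-α) := by positivity
    have hp2 : 0 < ε ^ (-α) * l ^ (α / 2) := by positivity
    have hεs : (ε / s) ^ (-α) = ε ^ (-α) * l ^ (α / 2) := by
      rw [Real.div_rpow hε0.le hs0.le, Real.rpow_neg hs0.le, div_inv_eq_mul, hs,
        Real.sqrt_eq_rpow, ← Real.rpow_mul hl.le]
      congr 2
      ring
    rcases min_choice (L₀ / 2) (ε / s) with h | h
    · rw [hLdef, h]; linarith
    · rw [hLdef, h, hεs]; linarith
  -- Squared form of the final bound, since the averaging estimate compares squared norms.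
  have hconst : 4 * t⁻¹ ≤ ((a + b) * Real.exp ((a + b) * l ^ (α / 2))) ^ 2 := by
    have hlp : 0 < l ^ (α / 2) := by positivity
    calc 4 * t⁻¹ = (2 / Real.sqrt c₀ * Real.exp (C / 2 * L ^ (-α))) ^ 2 := by
          rw [mul_pow, div_pow, Real.sq_sqrt hc₀.le, ← Real.exp_nat_mul, ht, mul_inv,
            ← Real.exp_neg]
          have : -(-C * L ^ (-α)) = ((2 : ℕ) : ℝ) * (C / 2 * L ^ (-α)) := by push_cast; ring
          rw [this]
          ring
      _ ≤ (2 / Real.sqrt c₀ * Real.exp (C / 2 * (L₀ / 2) ^ (-α) + b * l ^ (α / 2))) ^ 2 := by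
          gcongr
          calc C / 2 * L ^ (-α) ≤ C / 2 * ((L₀ / 2) ^ (-α) + ε ^ (-α) * l ^ (α / 2)) := by gcongr
            _ = _ := by rw [hb]; ring
      _ = (a * Real.exp (b * l ^ (α / 2))) ^ 2 := by rw [Real.exp_add, ha]; ring
      _ ≤ _ := by gcongr <;> linarith
  refine (ENNReal.pow_le_pow_left_iff (two_ne_zero)).1 (hmain.trans ?_)
  rw [mul_pow, ← ENNReal.ofReal_pow (by positivity)]
  refine mul_le_mul_left ?_ _
  rw [← ENNReal.ofReal_inv_of_pos ht0, ← ENNReal.ofReal_ofNat, ← ENNReal.ofReal_mul (by norm_num)]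
  exact ENNReal.ofReal_le_ofReal hconst
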